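/- **Theorem 1.3 (Symmetry).** A *square-tiled surface* is a connected closed translation surface obtained from finitely many unit squares by gluing, by translations, right sides to left sides and top sides to bottom sides; equivalently it is given by two permutations $\mathrm{right},\mathrm{up}$ of the set of squares which generate a transitive group. Its *Veech group* is its stabilizer in $SL_2(\mathbb{R})$, i.e. the group of the linear parts $A\in SL_2(\mathbb{R})$ of the self-homeomorphisms that preserve the set of cone points and are affine with linear part $A$ in the flat coordinates away from the cone points. A square-tiled surface is *reduced* if the only genus-one square-tiled surface that it covers with branching over a single point is the torus made from one square. There is no reduced square-tiled surface of genus two whose Veech group is equal to $SL_2(\mathbb{Z})$. -/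

import Mathlib

/-- A (connected) square-tiled surface made from `n` unit squares, given by its gluing permutations:
the right side of square `i` is glued to the left side of square `right i`, and the top side of
square `i` is glued to the bottom side of square `up i`, by translations. -/
structure SquareTiledSurface (n : ℕ) where
  right : Equiv.Perm (Fin n)
  up : Equiv.Perm (Fin n)
  pos : 0 < n
  connected : ∀ i j : Fin n, ∃ g ∈ Subgroup.closure {right, up}, g i = j

/-- The closed unit square `[0,1] × [0,1]` in the plane. -/
abbrev UnitSquare : Type := Set.Icc (0 : Fin 2 → ℝ) 1

namespace SquareTiledSurface

variable {n : ℕ}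

/-- Side identifications among the points of the disjoint union of the `n` closed squares. -/
inductive Glue (O : SquareTiledSurface n) : Fin n × UnitSquare → Fin n × UnitSquare → Prop
  | right (i : Fin n) (x y : UnitSquare) (hx : x.1 0 = 1) (hy : y.1 0 = 0) (h : x.1 1 = y.1 1) :
      Glue O (i, x) (O.right i, y)
  | up (i : Fin n) (x y : UnitSquare) (hx : x.1 1 = 1) (hy : y.1 1 = 0) (h : x.1 0 = y.1 0) :
      Glue O (i, x) (O.up i, y)

/-- The underlying topological space of the surface: `n` closed squares with their sides glued,
with the quotient topology. -/
abbrev Surface (O : SquareTiledSurface n) : Type := Quot O.Glue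

/-- The point of the surface with coordinates `x` in the square `i`. -/
def point (O : SquareTiledSurface n) (i : Fin n) (x : UnitSquare) : O.Surface :=
  Quot.mk O.Glue (i, x)

/-- Turning once (by the angle `2π`, counterclockwise) about the lower left corner of the square
`i`, one passes through the squares `right⁻¹ i`, `up⁻¹ (right⁻¹ i)`, `right (up⁻¹ (right⁻¹ i))`
and arrives in the square `turn i`, at the lower left corner of that square. -/
def turn (O : SquareTiledSurface n) : Equiv.Perm (Fin n) :=
  O.up * O.right * O.up⁻¹ * O.right⁻¹

/-- Vertices of the tiling. Each vertex is the lower left corner of some square, and two squares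
have the same vertex as lower left corner exactly when they lie in one cycle of `turn`
(fixed points of `turn` being cycles of length one). The cone angle at the vertex is `2π` times
the length of this cycle. -/
def Vertex (O : SquareTiledSurface n) : Type :=
  Quotient (Equiv.Perm.SameCycle.setoid O.turn)

/-- Euler characteristic `V - E + F` of the tiling: there are `2 * n` edges (the bottom side and the
left side of each square) and `n` faces. -/
noncomputable def eulerChar (O : SquareTiledSurface n) : ℤ :=
  (Nat.card O.Vertex : ℤ) - 2 * n + n

/-- The surface, which is closed, connected and oriented, has genus `g`. -/
def HasGenus (O : SquareTiledSurface n) (g : ℕ) : Prop :=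
  O.eulerChar = 2 - 2 * g

/-- The cone points (singularities): the vertices with cone angle greater than `2π`. -/
def conePoints (O : SquareTiledSurface n) : Set O.Surface :=
  {p | ∃ (i : Fin n) (x : UnitSquare), x.1 = 0 ∧ O.turn i ≠ i ∧ p = O.point i x}

open scoped Matrix in
/-- The self-homeomorphism `f` is affine with linear part `A` (that is, `f` is an isomorphism of
translation surfaces from `A · O` to `O`): it preserves the set of cone points and, away from the
cone points, it is of the form `x' ↦ y + A (x' - x)` in the coordinates of the squares, near each
point `x` of each (closed) square `i` and with values read in each (closed) square `j` that
contains the image of `x`, at `y`. -/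
def IsAffine (O : SquareTiledSurface n) (A : Matrix (Fin 2) (Fin 2) ℝ)
    (f : O.Surface ≃ₜ O.Surface) : Prop :=
  f '' O.conePoints = O.conePoints ∧
  ∀ (i : Fin n) (x : UnitSquare) (j : Fin n) (y : UnitSquare),
    O.point i x ∉ O.conePoints → f (O.point i x) = O.point j y →
    ∀ᶠ x' in nhds x, ∀ y' : UnitSquare, y'.1 - y.1 = A *ᵥ (x'.1 - x.1) →
      f (O.point i x') = O.point j y'

/-- The Veech group: the stabilizer of the translation surface in `SL₂(ℝ)`, i.e. the set of linear
parts of its affine homeomorphisms. -/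
def veechGroup (O : SquareTiledSurface n) : Set (Matrix.SpecialLinearGroup (Fin 2) ℝ) :=
  {A | ∃ f : O.Surface ≃ₜ O.Surface, O.IsAffine A.1 f}

/-- `π`, a map from the squares of `O` to the squares of `O'`, is a covering of square-tiled
surfaces (possibly branched at vertices): it respects the gluings. -/
def IsCovering {m : ℕ} (O : SquareTiledSurface n) (O' : SquareTiledSurface m)
    (π : Fin n → Fin m) : Prop :=
  ∀ i, π (O.right i) = O'.right (π i) ∧ π (O.up i) = O'.up (π i)

/-- The covering `π` is ramified at the lower left corner of the square `i`: some number of turns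
about the image of this corner that closes up in `O'` does not close up in `O`. -/
def IsRamifiedAt {m : ℕ} (O : SquareTiledSurface n) (O' : SquareTiledSurface m)
    (π : Fin n → Fin m) (i : Fin n) : Prop :=
  ∃ k : ℕ, (O'.turn ^ k) (π i) = π i ∧ (O.turn ^ k) i ≠ i

/-- The covering `π` is branched over (at most) a single point: all its ramification points lie over
one vertex of `O'`. -/
def BranchedOverOnePoint {m : ℕ} (O : SquareTiledSurface n) (O' : SquareTiledSurface m)
    (π : Fin n → Fin m) : Prop :=
  ∃ j : Fin m, ∀ i, O.IsRamifiedAt O' π i → O'.turn.SameCycle j (π i)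

/-- Reduced: the only square-tiled surface of genus one that `O` covers with branching over a single
point is the torus made from one square. -/
def IsReduced (O : SquareTiledSurface n) : Prop :=
  ∀ (m : ℕ) (O' : SquareTiledSurface m) (π : Fin n → Fin m),
    O'.HasGenus 1 → O.IsCovering O' π → O.BranchedOverOnePoint O' π → m = 1

end SquareTiledSurface

/-!
Write `c = u r u⁻¹ r⁻¹` for the commutator of the gluing permutations `r = right` and `u = up`; it
turns squares once about their lower left corners, and genus two means that `c` is a three-cycle
(one cone point of angle `6π`) or a product of two disjoint transpositions (two cone points of
angle `4π`).

*From the surface to permutations.* An affine homeomorphism `f` with integral linear part `A` covers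
the linear map `A` of the torus `(ℝ / ℤ)²`: the difference of the two maps to the torus is locally
constant away from the cone points, hence constant, and it vanishes at the cone points, which `f`
preserves (`SquareTiledSurface.IsAffine.toTorus_apply`). So `f` maps the pieces of squares cut out by
the preimage of the tiling into single squares, and comparing both sides of the edges shows how it
acts on the gluings. If the Veech group is `SL₂(ℤ)`, the quarter turn and the shear give
permutations `δ` and `σ` of the squares with `δ r δ⁻¹ = u⁻¹`, `δ u δ⁻¹ = u r u⁻¹`, `σ r σ⁻¹ = r` and
`σ u σ⁻¹ = u r`. Both commute with `c`.

*Permutations.* On the free group on `r` and `u`, the fourth power of the quarter turn is conjugation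
by `c`, and the quarter turn and the shear satisfy the braid relation. So `c⁻¹ δ⁴` and
`δ⁻² (δ σ⁻¹)³` commute with `r` and `u`: they are translation automorphisms of the surface.

* If `c` is a three-cycle, its centralizer acts on the support of `c` through a cyclic group of order
  three, where these two relations force `c` to agree with a translation automorphism `α`
  (`not_isThreeCycle_commutator`). This cannot be: `r` and `u` commute with `α`, and the total shift
  along the cycles of `α` is a homomorphism to an abelian group, which is trivial on `c` but also
  equal to one step (`Equiv.Perm.commutator_ne_of_eq_on_single_cycle`).
* If `c` is a product of two transpositions, `δ⁴` is trivial on its support, so that `α = c⁻¹ δ⁴`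
  agrees with `c` there (`commutator_ne_of_involution`). The quotient by `α` is a torus with two
  marked points, which are fixed or exchanged by the quarter turn and the shear. Their difference is
  then invariant up to sign under `SL₂(ℤ)`, so it is zero (`torus_eq_of_invariant_pair`), although
  the two points are distinct.
-/

/-! ### Permutations with two cycles fewer than elements, and actions on cycles -/

open Equiv.Perm in
/-- A permutation of a finite set with exactly two cycles fewer than elements (fixed points being
counted as cycles) is a three-cycle or a product of two disjoint transpositions. -/
theorem Equiv.Perm.isThreeCycle_or_exists_of_card_eq {X : Type*} [Fintype X] [DecidableEq X]
    (c : Equiv.Perm X)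
    (hc : Nat.card (Quotient (SameCycle.setoid c)) + 2 = Fintype.card X) :
    c.IsThreeCycle ∨ ∃ a b, c a ≠ a ∧ c b ≠ b ∧ (∀ x, c (c x) = x) ∧ ¬ c.SameCycle a b ∧
      ∀ x, c x ≠ x → x = a ∨ x = c a ∨ x = b ∨ x = c b := by
  classical
  set o : X → X := fun x => (Quotient.mk (SameCycle.setoid c) x).out with ho
  have ho_rel : ∀ x, c.SameCycle (o x) x := fun x =>
    Quotient.exact (s := SameCycle.setoid c) (Quotient.out_eq (Quotient.mk _ x))
  have ho_eq : ∀ x y, c.SameCycle x y → o x = o y := fun x y h => by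
    simp only [ho]; rw [Quotient.sound (s := SameCycle.setoid c) h]
  -- The elements which are not the chosen representative of their cycle: there are two of them.
  have hcard : (Finset.univ.filter fun x => o x ≠ x).card = 2 := by
    have h1 : (Finset.univ.filter fun x => o x = x).card =
        Nat.card (Quotient (SameCycle.setoid c)) := by
      rw [Nat.card_eq_fintype_card, ← Finset.card_univ]
      refine Finset.card_bij' (fun x _ => Quotient.mk _ x) (fun q _ => q.out) ?_ ?_ ?_ ?_
      · intros; simp
      · intro q _; simp [ho]
      · intro x hx; simpa [ho] using hx
      · intro q _; simp
    have h2 := Finset.card_filter_add_card_filter_not (s := (Finset.univ : Finset X))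
      (fun x => o x = x)
    rw [h1, Finset.card_univ] at h2
    have h3 : (Finset.univ.filter fun x => o x ≠ x) = Finset.univ.filter fun x => ¬ o x = x := rfl
    rw [h3]
    omega
  obtain ⟨a, b, hab, hR⟩ := Finset.card_eq_two.1 hcard
  have hmem : ∀ x, o x ≠ x ↔ x = a ∨ x = b := fun x => by
    have := Finset.ext_iff.1 hR x
    simpa using this
  have ha : o a ≠ a := (hmem a).2 (Or.inl rfl)
  have hb : o b ≠ b := (hmem b).2 (Or.inr rfl)
  have hfix : ∀ x y, c.SameCycle x y → c x = x → x = y := fun x y h hx =>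
    (h.eq_of_left hx)
  have hmove : ∀ x, c x ≠ x → x = o x ∨ x = a ∨ x = b := fun x _ => by
    by_cases h : o x = x
    · exact Or.inl h.symm
    · exact Or.inr ((hmem x).1 h)
  have hmove' : ∀ x, c x ≠ x → o x = o a ∨ o x = o b := fun x hx => by
    by_cases h : o x = x
    · have h1 : o (c x) = o x := ho_eq _ _ (sameCycle_apply_left.2 (SameCycle.refl _ _))
      have h2 : o (c x) ≠ c x := by rw [h1, h]; exact hx.symm
      rcases (hmem _).1 h2 with h3 | h3
      · left; rw [← h1, h3]
      · right; rw [← h1, h3]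
    · rcases (hmem _).1 h with h3 | h3
      · left; rw [h3]
      · right; rw [h3]
  have hca : c a ≠ a := fun h => ha (hfix _ _ (ho_rel a).symm h).symm
  have hcb : c b ≠ b := fun h => hb (hfix _ _ (ho_rel b).symm h).symm
  have hoa : c (o a) ≠ o a := fun h => ha (hfix _ _ (ho_rel a) h)
  have hob : c (o b) ≠ o b := fun h => hb (hfix _ _ (ho_rel b) h)
  by_cases hs : c.SameCycle a b
  · left
    have hoab := ho_eq _ _ hs
    rw [← card_support_eq_three_iff]
    have : c.support = {o a, a, b} := by
      ext x
      simp only [mem_support, Finset.mem_insert, Finset.mem_singleton]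
      constructor
      · intro hx
        rcases hmove x hx with h | h | h
        · left
          rcases hmove' x hx with h' | h'
          · rw [h, h']
          · rw [h, h', hoab]
        · exact Or.inr (Or.inl h)
        · exact Or.inr (Or.inr h)
      · rintro (h | h | h) <;> subst h <;> assumption
    rw [this]
    refine Finset.card_eq_three.2 ⟨o a, a, b, ha, ?_, hab, rfl⟩
    rw [hoab]; exact hb
  · right
    have hoab : o a ≠ o b := fun h => hs (((ho_rel a).symm.trans (h ▸ SameCycle.refl _ _)).trans
      (ho_rel b))
    have key : ∀ x, c x ≠ x → x = o a ∨ x = a ∨ x = o b ∨ x = b := fun x hx => by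
      rcases hmove x hx with h | h | h
      · rcases hmove' x hx with h' | h'
        · left; rw [h, h']
        · right; right; left; rw [h, h']
      · exact Or.inr (Or.inl h)
      · exact Or.inr (Or.inr (Or.inr h))
    have hoo : ∀ x, o (o x) = o x := fun x => ho_eq _ _ (ho_rel x)
    have hoc : ∀ x, o (c x) = o x := fun x =>
      ho_eq _ _ (sameCycle_apply_left.2 (SameCycle.refl _ _))
    have hcc : ∀ x, c x ≠ x → c (c x) ≠ c x := fun x hx h => hx (c.injective h)
    have h1 : c a = o a := by
      have e := hoc a
      rcases key _ (hcc _ hca) with h | h | h | h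
      · exact h
      · exact absurd h hca
      · rw [h, hoo] at e; exact absurd e.symm hoab
      · rw [h] at e; exact absurd e.symm hoab
    have h2 : c (o a) = a := by
      have e := hoc (o a)
      rw [hoo] at e
      rcases key _ (hcc _ hoa) with h | h | h | h
      · exact absurd h hoa
      · exact h
      · rw [h, hoo] at e; exact absurd e.symm hoab
      · rw [h] at e; exact absurd e.symm hoab
    have h3 : c b = o b := by
      have e := hoc b
      rcases key _ (hcc _ hcb) with h | h | h | h
      · rw [h, hoo] at e; exact absurd e hoab
      · rw [h] at e; exact absurd e hoab
      · exact h
      · exact absurd h hcb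
    have h4 : c (o b) = b := by
      have e := hoc (o b)
      rw [hoo] at e
      rcases key _ (hcc _ hob) with h | h | h | h
      · rw [h, hoo] at e; exact absurd e hoab
      · rw [h] at e; exact absurd e hoab
      · exact absurd h hob
      · exact h
    refine ⟨a, b, hca, hcb, fun x => ?_, hs, fun x hx => ?_⟩
    · by_cases hx : c x = x
      · rw [hx, hx]
      · rcases key x hx with h | h | h | h <;> subst h
        · rw [h2, h1]
        · rw [h1, h2]
        · rw [h4, h3]
        · rw [h3, h4]
    · rw [h1, h3]
      rcases key x hx with h | h | h | h <;> simp [h]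

/-- The permutations commuting with `α` permute the cycles of `α`. -/
def Equiv.Perm.onCycles {X : Type*} (α : Equiv.Perm X) :
    Subgroup.centralizer {α} →* Equiv.Perm (Quotient (Equiv.Perm.SameCycle.setoid α)) where
  toFun g := Quotient.congr g.1 fun x y => by
    have hg : g.1⁻¹ * α * g.1 = α := by
      have := Subgroup.mem_centralizer_singleton_iff.1 g.2
      rw [mul_assoc, ← this]; group
    have := Equiv.Perm.sameCycle_conj (f := α) (g := g.1⁻¹) (x := x) (y := y)
    rw [inv_inv, hg] at this
    exact this
  map_one' := by ext q; induction q using Quotient.inductionOn; rfl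
  map_mul' g h := by ext q; induction q using Quotient.inductionOn; rfl

theorem Equiv.Perm.onCycles_mk {X : Type*} (α : Equiv.Perm X) (g : Subgroup.centralizer {α})
    (x : X) : α.onCycles g (Quotient.mk _ x) = Quotient.mk _ (g.1 x) := rfl

/-! ### Commutators, the braid relation, and invariant pairs of points of a torus -/

open Equiv.Perm in
/-- Let `α` be a permutation whose powers other than `1` have no fixed points. A commutator of two
permutations commuting with `α` cannot be equal to `α` on one cycle of `α` and fix everything else.
Indeed, a permutation commuting with `α` shifts each cycle of `α` by a residue modulo the order
of `α` before permuting the cycles, and the sum of these residues is additive, so that it vanishes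
on commutators. -/
theorem Equiv.Perm.commutator_ne_of_eq_on_single_cycle {X : Type*} [Fintype X] [DecidableEq X]
    {α r u : Equiv.Perm X} (hα : α ≠ 1)
    (hfree : ∀ (m : ℤ) (x : X), (α ^ m) x = x → α ^ m = 1)
    (hr : Commute α r) (hu : Commute α u) {p : X}
    (hp : (u * r * u⁻¹ * r⁻¹) p = α p)
    (hS : ∀ x, (u * r * u⁻¹ * r⁻¹) x ≠ x → α.SameCycle p x) : False := by
  classical
  let Q := Quotient (SameCycle.setoid α)
  have : Fintype Q := Fintype.ofFinite Q
  have ho : ∀ x, ∃ k : ℤ, (α ^ k) (Quotient.mk (SameCycle.setoid α) x).out = x := fun x =>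
    Quotient.exact (s := SameCycle.setoid α) (Quotient.out_eq (Quotient.mk _ x))
  choose k hk using ho
  -- `κ x` is the position of `x` in its cycle.
  let κ : X → ZMod (orderOf α) := fun x => (k x : ZMod (orderOf α))
  have hκ : ∀ x, κ (α x) = κ x + 1 := fun x => by
    have hq : Quotient.mk (SameCycle.setoid α) (α x) = Quotient.mk (SameCycle.setoid α) x :=
      Quotient.sound (s := SameCycle.setoid α) (sameCycle_apply_left.2 (SameCycle.refl _ _))
    have h1 := hk (α x)
    rw [hq] at h1
    have h2 : (α ^ (k (α x) - (k x + 1)))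
        (Quotient.mk (SameCycle.setoid α) x).out = (Quotient.mk (SameCycle.setoid α) x).out := by
      rw [sub_eq_neg_add, zpow_add, mul_apply, h1, zpow_neg, inv_eq_iff_eq, add_comm, zpow_add,
        mul_apply, hk x, zpow_one]
    have h3 := orderOf_dvd_iff_zpow_eq_one.2 (hfree _ _ h2)
    have h4 := (ZMod.intCast_zmod_eq_zero_iff_dvd _ _).2 h3
    push_cast at h4
    exact sub_eq_zero.1 h4
  let C := Subgroup.centralizer {α}
  have hC : ∀ g : C, ∀ x, g.1 (α x) = α (g.1 x) := fun g x => by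
    have := Subgroup.mem_centralizer_singleton_iff.1 g.2
    exact DFunLike.congr_fun this x
  -- the amount by which `g` shifts the cycle of `x`
  let d : C → X → ZMod (orderOf α) := fun g x => κ (g.1 x) - κ x
  have hdα : ∀ g x, d g (α x) = d g x := fun g x => by
    simp only [d, hC, hκ]; ring
  have hdcyc : ∀ g x y, α.SameCycle x y → d g x = d g y := by
    intro g x y ⟨i, hi⟩
    subst hi
    have hnat : ∀ (j : ℕ) (x : X), d g ((α ^ j) x) = d g x := fun j => by
      induction j with
      | zero => intro x; simp
      | succ j ih => intro x; rw [pow_succ', mul_apply, hdα, ih]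
    obtain ⟨j, rfl | rfl⟩ := i.eq_nat_or_neg
    · rw [zpow_natCast, hnat]
    · rw [← hnat j ((α ^ (-(j : ℤ))) x), ← zpow_natCast, ← mul_apply, ← zpow_add]; simp
  let dq : C → Q → ZMod (orderOf α) := fun g =>
    Quotient.lift (d g) fun x y h => hdcyc g x y h
  let D : C →* Multiplicative (ZMod (orderOf α)) :=
    { toFun := fun g => Multiplicative.ofAdd (∑ q, dq g q)
      map_one' := by
        have : ∀ q, dq 1 q = 0 := fun q => by
          induction q using Quotient.inductionOn
          simp [dq, d]
        simp [this]
      map_mul' := fun g h => by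
        have : ∀ q, dq (g * h) q = dq g (α.onCycles h q) + dq h q := fun q => by
          induction q using Quotient.inductionOn
          simp [dq, d, onCycles_mk]
        rw [← ofAdd_add, Finset.sum_congr rfl fun q _ => this q, Finset.sum_add_distrib,
          Equiv.sum_comp] }
  let r' : C := ⟨r, Subgroup.mem_centralizer_singleton_iff.2 hr.symm⟩
  let u' : C := ⟨u, Subgroup.mem_centralizer_singleton_iff.2 hu.symm⟩
  have h1 : D (u' * r' * u'⁻¹ * r'⁻¹) = 1 := by
    simp only [map_mul, map_inv]
    rw [mul_comm (D u'), mul_inv_cancel_right, mul_inv_cancel]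
  have h2 : ∑ q, dq (u' * r' * u'⁻¹ * r'⁻¹) q = 0 := h1
  rw [Finset.sum_eq_single (Quotient.mk _ p)] at h2
  · have h3 : κ ((u * r * u⁻¹ * r⁻¹) p) - κ p = 0 := h2
    rw [hp, hκ, add_sub_cancel_left] at h3
    have h4 : ((1 : ℕ) : ZMod (orderOf α)) = 0 := by simpa using h3
    rw [ZMod.natCast_eq_zero_iff, Nat.dvd_one, orderOf_eq_one_iff] at h4
    exact hα h4
  · intro q _ hq
    induction q using Quotient.inductionOn with | _ x => ?_
    by_contra hx
    refine hq (Quotient.sound (s := SameCycle.setoid α) (hS x fun h => hx ?_).symm)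
    have h' : κ ((u * r * u⁻¹ * r⁻¹) x) - κ x = 0 := by rw [h, sub_self]
    exact h'
  · simp

/-- A permutation commuting with two permutations which generate a transitive group is determined
by its value at one point. -/
theorem Equiv.Perm.eq_of_commute_of_apply_eq {X : Type*} {r u γ γ' : Equiv.Perm X}
    (htrans : ∀ x y, ∃ g ∈ Subgroup.closure {r, u}, g x = y)
    (hr : Commute γ r) (hu : Commute γ u) (hr' : Commute γ' r) (hu' : Commute γ' u) {x : X}
    (hx : γ x = γ' x) : γ = γ' := by
  ext y
  obtain ⟨g, hg, rfl⟩ := htrans x y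
  have h : ∀ {β : Equiv.Perm X}, Commute β r → Commute β u → Commute β g := by
    intro β h1 h2
    have : Subgroup.closure {r, u} ≤ Subgroup.centralizer {β} := by
      rw [Subgroup.closure_le]
      rintro _ (rfl | rfl)
      · exact Subgroup.mem_centralizer_singleton_iff.2 h1.symm
      · exact Subgroup.mem_centralizer_singleton_iff.2 h2.symm
    exact (Subgroup.mem_centralizer_singleton_iff.1 (this hg)).symm
  have h1 := DFunLike.congr_fun (h hr hu).eq x
  have h2 := DFunLike.congr_fun (h hr' hu').eq x
  simp only [Equiv.Perm.mul_apply] at h1 h2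
  rw [h1, h2, hx]

section QuarterTurn

variable {G : Type*} [Group G] {r u δ σ : G}

theorem commute_inv_mul_of_conj_eq {g h x : G} (e : MulAut.conj g x = MulAut.conj h x) :
    Commute (h⁻¹ * g) x := by
  rw [MulAut.conj_apply, MulAut.conj_apply, mul_inv_eq_iff_eq_mul] at e
  rw [Commute, SemiconjBy, mul_assoc, e]
  group

/-- If conjugation by `δ` is the quarter turn `r ↦ u⁻¹`, `u ↦ u r u⁻¹`, then conjugation by `δ ^ 4`
is conjugation by the commutator of `u` and `r`. -/
theorem quarterTurn_pow_four_commute (hr : MulAut.conj δ r = u⁻¹)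
    (hu : MulAut.conj δ u = u * r * u⁻¹) :
    Commute ((u * r * u⁻¹ * r⁻¹)⁻¹ * δ ^ 4) r ∧ Commute ((u * r * u⁻¹ * r⁻¹)⁻¹ * δ ^ 4) u := by
  constructor <;> apply commute_inv_mul_of_conj_eq <;>
  · simp only [pow_succ, pow_zero, one_mul, MulAut.mul_apply, hr, hu, map_mul, map_inv]
    simp only [MulAut.conj_apply, MulAut.conj_inv_apply]
    group

/-- The braid relation: if moreover conjugation by `σ` is the shear `r ↦ r`, `u ↦ u r`, then
conjugations by `(δ σ⁻¹) ^ 3` and by `δ ^ 2` agree. -/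
theorem quarterTurn_shear_braid_commute (hr : MulAut.conj δ r = u⁻¹)
    (hu : MulAut.conj δ u = u * r * u⁻¹) (hσr : MulAut.conj σ r = r)
    (hσu : MulAut.conj σ u = u * r) :
    Commute ((δ ^ 2)⁻¹ * (δ * σ⁻¹) ^ 3) r ∧ Commute ((δ ^ 2)⁻¹ * (δ * σ⁻¹) ^ 3) u := by
  have h1 : (MulAut.conj σ)⁻¹ r = r := by
    rw [MulAut.inv_apply, MulEquiv.symm_apply_eq, hσr]
  have h2 : (MulAut.conj σ)⁻¹ u = u * r⁻¹ := by
    rw [MulAut.inv_apply, MulEquiv.symm_apply_eq, map_mul, map_inv, hσr, hσu]; group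
  constructor <;> apply commute_inv_mul_of_conj_eq <;>
  · simp only [map_mul, map_inv, pow_succ, pow_zero, one_mul, MulAut.mul_apply, hr, hu,
      h1, h2]
    group

theorem commute_commutator_of_quarterTurn (hr : MulAut.conj δ r = u⁻¹)
    (hu : MulAut.conj δ u = u * r * u⁻¹) : Commute δ (u * r * u⁻¹ * r⁻¹) := by
  have : MulAut.conj δ (u * r * u⁻¹ * r⁻¹) = u * r * u⁻¹ * r⁻¹ := by
    simp only [map_mul, map_inv, hr, hu]; group
  rwa [MulAut.conj_apply, mul_inv_eq_iff_eq_mul] at this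

theorem commute_commutator_of_shear (hσr : MulAut.conj σ r = r) (hσu : MulAut.conj σ u = u * r) :
    Commute σ (u * r * u⁻¹ * r⁻¹) := by
  have : MulAut.conj σ (u * r * u⁻¹ * r⁻¹) = u * r * u⁻¹ * r⁻¹ := by
    simp only [map_mul, map_inv, hσr, hσu]; group
  rwa [MulAut.conj_apply, mul_inv_eq_iff_eq_mul] at this

end QuarterTurn

section Permutations

variable {X : Type*} {r u δ σ : Equiv.Perm X}

/-- Two points of a torus tiled by squares which are exchanged or fixed both by the shear and by the
quarter turn coincide. The displacement `r ^ i * u ^ j` between the two points is determined modulo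
the periods of the torus, and the periods form `m ℤ × m ℤ` for some `m`; invariance up to sign
under the shear and the quarter turn makes the displacement a period. -/
theorem torus_eq_of_invariant_pair (hcomm : Commute r u)
    (htrans : ∀ x y : X, ∃ i j : ℤ, (r ^ i * u ^ j) x = y)
    (hr : MulAut.conj δ r = u⁻¹) (hu : MulAut.conj δ u = r)
    (hσr : MulAut.conj σ r = r) (hσu : MulAut.conj σ u = u * r) {p q : X}
    (hδ : δ p = p ∧ δ q = q ∨ δ p = q ∧ δ q = p)
    (hσ : σ p = p ∧ σ q = q ∨ σ p = q ∧ σ q = p) : p = q := by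
  have hadd : ∀ i j k l : ℤ, r ^ (i + k) * u ^ (j + l) = (r ^ i * u ^ j) * (r ^ k * u ^ l) := by
    intro i j k l
    rw [zpow_add, zpow_add, mul_assoc, mul_assoc, ← mul_assoc (r ^ k),
      ← mul_assoc (u ^ j), (hcomm.zpow_zpow k j).eq, mul_assoc]
  have hcommg : ∀ i j k l : ℤ, Commute (r ^ i * u ^ j) (r ^ k * u ^ l) := by
    intro i j k l
    rw [Commute, SemiconjBy, ← hadd, ← hadd, add_comm i, add_comm j]
  -- the group generated by `r` and `u` acts freely
  have hfree : ∀ {i j : ℤ} {x : X}, (r ^ i * u ^ j) x = x → r ^ i * u ^ j = 1 := by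
    intro i j x hx
    ext y
    obtain ⟨k, l, rfl⟩ := htrans x y
    have := DFunLike.congr_fun (hcommg i j k l).eq x
    simp only [Equiv.Perm.mul_apply] at this hx ⊢
    rw [this, hx]; rfl
  have hfree' : ∀ {i j k l : ℤ} {x : X}, (r ^ i * u ^ j) x = (r ^ k * u ^ l) x →
      r ^ (i - k) * u ^ (j - l) = 1 := by
    intro i j k l x h
    refine hfree (x := (r ^ k * u ^ l) x) ?_
    rw [← Equiv.Perm.mul_apply, ← hadd, sub_add_cancel, sub_add_cancel, h]
  have hσc : ∀ (i j : ℤ) (x : X), σ ((r ^ i * u ^ j) x) = (r ^ (i + j) * u ^ j) (σ x) := by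
    intro i j x
    have : MulAut.conj σ (r ^ i * u ^ j) = r ^ (i + j) * u ^ j := by
      rw [map_mul, map_zpow, map_zpow, hσr, hσu, hcomm.symm.mul_zpow, zpow_add, mul_assoc,
        (hcomm.zpow_zpow j j).eq]
    rw [← this, MulAut.conj_apply]; simp
  have hδc : ∀ (i j : ℤ) (x : X), δ ((r ^ i * u ^ j) x) = (r ^ j * u ^ (-i)) (δ x) := by
    intro i j x
    have : MulAut.conj δ (r ^ i * u ^ j) = r ^ j * u ^ (-i) := by
      rw [map_mul, map_zpow, map_zpow, hr, hu, inv_zpow', (hcomm.zpow_zpow j (-i)).eq]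
    rw [← this, MulAut.conj_apply]; simp
  have hΛσ : ∀ {i j : ℤ}, r ^ i * u ^ j = 1 → r ^ (i + j) * u ^ j = 1 := by
    intro i j h
    refine hfree (x := σ p) ?_
    rw [← hσc, h]; rfl
  have hΛδ : ∀ {i j : ℤ}, r ^ i * u ^ j = 1 → r ^ j * u ^ (-i) = 1 := by
    intro i j h
    refine hfree (x := δ p) ?_
    rw [← hδc, h]; rfl
  -- `k` is in `Y` if `(k, 0)` is a period
  let Y : AddSubgroup ℤ :=
    { carrier := {k | r ^ k = 1}
      add_mem' := fun {a b} ha hb => by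
        simp only [Set.mem_ofPred_eq] at *; rw [zpow_add, ha, hb, one_mul]
      zero_mem' := zpow_zero r
      neg_mem' := fun {a} ha => by
        simp only [Set.mem_ofPred_eq] at *; rw [zpow_neg, ha, inv_one] }
  have hY : ∀ {k : ℤ}, k ∈ Y ↔ r ^ k = 1 := Iff.rfl
  have hYu : ∀ {k : ℤ}, k ∈ Y → u ^ k = 1 := by
    intro k hk
    have h1 : r ^ (-k) * u ^ (0 : ℤ) = 1 := by rw [zpow_neg, hY.1 hk]; simp
    have := hΛδ h1
    simpa using this
  have hΛY : ∀ {i j : ℤ}, r ^ i * u ^ j = 1 → i ∈ Y ∧ j ∈ Y := by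
    intro i j h
    have h1 := hΛσ h
    have hj : j ∈ Y := by
      rw [add_comm, zpow_add, mul_assoc, h, mul_one] at h1
      exact h1
    refine ⟨?_, hj⟩
    rw [hYu hj, mul_one] at h
    exact h
  obtain ⟨i, j, hij⟩ := htrans p q
  -- rotating the displacement by a quarter turn gives the displacement or its negative
  have h1 : j - i ∈ Y ∧ i + j ∈ Y := by
    have e := hδc i j p
    rw [hij] at e
    rcases hδ with ⟨h1, h2⟩ | ⟨h1, h2⟩
    · rw [h1, h2, ← hij] at e
      obtain ⟨h3, h4⟩ := hΛY (hfree' e)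
      refine ⟨by rw [← neg_sub]; exact Y.neg_mem h3, ?_⟩
      rwa [sub_neg_eq_add, add_comm] at h4
    · rw [h1, h2, ← hij, ← Equiv.Perm.mul_apply, ← hadd] at e
      obtain ⟨h3, h4⟩ := hΛY (hfree e.symm)
      exact ⟨by rwa [sub_eq_neg_add], by rwa [add_comm]⟩
  have h2 : i ∈ Y ∧ j ∈ Y := by
    have e := hσc i j p
    rw [hij] at e
    rcases hσ with ⟨h3, h4⟩ | ⟨h3, h4⟩
    · rw [h3, h4, ← hij] at e
      obtain ⟨h5, -⟩ := hΛY (hfree' e)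
      have hj : j ∈ Y := by
        have := Y.neg_mem h5
        simpa using this
      exact ⟨by simpa using Y.sub_mem h1.2 hj, hj⟩
    · rw [h3, h4, ← hij, ← Equiv.Perm.mul_apply, ← hadd] at e
      obtain ⟨h5, -⟩ := hΛY (hfree e.symm)
      have hi : i ∈ Y := by
        have := Y.sub_mem h5 h1.2
        rwa [show i + j + i - (i + j) = i by ring] at this
      exact ⟨hi, by simpa using Y.sub_mem h1.2 hi⟩
  rw [hY.1 h2.1, hYu h2.2] at hij
  exact hij

end Permutations

/-! ### Gluing permutations invariant under the quarter turn and the shear -/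

section Permutations

variable {X : Type*} [Fintype X] [DecidableEq X] {r u δ σ : Equiv.Perm X}

/-- On a surface with a single cone point of angle `6π`, the shear and the quarter turn act on the
three squares with this corner through the cyclic group generated by the commutator. The braid
relation then makes the commutator agree, on these squares, with an automorphism of the surface. -/
theorem not_isThreeCycle_commutator
    (htrans : ∀ x y, ∃ g ∈ Subgroup.closure {r, u}, g x = y)
    (hr : MulAut.conj δ r = u⁻¹) (hu : MulAut.conj δ u = u * r * u⁻¹)
    (hσr : MulAut.conj σ r = r) (hσu : MulAut.conj σ u = u * r) :
    ¬ (u * r * u⁻¹ * r⁻¹).IsThreeCycle := by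
  intro h3
  have hcδ := commute_commutator_of_quarterTurn hr hu
  have hcσ := commute_commutator_of_shear hσr hσu
  obtain ⟨h1r, h1u⟩ := quarterTurn_shear_braid_commute hr hu hσr hσu
  obtain ⟨h2r, h2u⟩ := quarterTurn_pow_four_commute hr hu
  set c := u * r * u⁻¹ * r⁻¹ with hc
  obtain ⟨p, hp, hcyc⟩ := h3.isCycle
  have hc3 : c ^ (3 : ℤ) = 1 := by
    have := pow_orderOf_eq_one c
    rw [h3.orderOf] at this
    exact_mod_cast this
  have hpow : ∀ {g : Equiv.Perm X}, Commute g c → ∃ k : ℤ, g p = (c ^ k) p := by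
    intro g hg
    have hgp : c (g p) ≠ g p := by
      have := DFunLike.congr_fun hg.eq p
      simp only [Equiv.Perm.mul_apply] at this
      rw [← this]
      exact fun h => hp (g.injective h)
    obtain ⟨k, hk⟩ := hcyc hgp
    exact ⟨k, hk.symm⟩
  have hmul : ∀ {g h : Equiv.Perm X} {k l : ℤ}, Commute g c → g p = (c ^ k) p → h p = (c ^ l) p →
      (g * h) p = (c ^ (k + l)) p := by
    intro g h k l hg h1 h2
    have := DFunLike.congr_fun (hg.zpow_right l).eq p
    simp only [Equiv.Perm.mul_apply] at this
    rw [Equiv.Perm.mul_apply, h2, this, h1, add_comm, zpow_add, Equiv.Perm.mul_apply]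
  have hinv : ∀ {g : Equiv.Perm X} {k : ℤ}, Commute g c → g p = (c ^ k) p →
      g⁻¹ p = (c ^ (-k)) p := by
    intro g k hg h1
    have := DFunLike.congr_fun (hg.zpow_right (-k)).eq p
    simp only [Equiv.Perm.mul_apply] at this
    rw [Equiv.Perm.inv_eq_iff_eq, this, h1, ← Equiv.Perm.mul_apply, ← zpow_add]
    simp
  obtain ⟨k, hk⟩ := hpow hcδ
  obtain ⟨l, hl⟩ := hpow hcσ
  have hε : (δ * σ⁻¹) p = (c ^ (k + -l)) p := hmul hcδ hk (hinv hcσ hl)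
  have hcε : Commute (δ * σ⁻¹) c := hcδ.mul_left hcσ.inv_left
  have hγ₁ := hmul ((hcδ.pow_left 2).inv_left)
    (hinv (hcδ.pow_left 2) (by rw [pow_two]; exact hmul hcδ hk hk))
    (show ((δ * σ⁻¹) ^ 3) p = _ by
      rw [pow_succ, pow_two]; exact hmul (hcε.mul_left hcε) (hmul hcε hε hε) hε)
  have hγ₂ := hmul (Commute.refl c).inv_left
    (hinv (Commute.refl c) (by rw [zpow_one] : c p = (c ^ (1 : ℤ)) p))
    (show (δ ^ 4) p = _ by
      rw [pow_succ, pow_succ, pow_two]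
      exact hmul ((hcδ.mul_left hcδ).mul_left hcδ)
        (hmul (hcδ.mul_left hcδ) (hmul hcδ hk hk) hk) hk)
  have hcomm : ∀ {g : Equiv.Perm X}, Commute g r → Commute g u → Commute g c := fun h1 h2 =>
    ((h2.mul_right h1).mul_right h2.inv_right).mul_right h1.inv_right
  -- the exponents are chosen so that `α` agrees with `c` at `p`
  let α : Equiv.Perm X := ((δ ^ 2)⁻¹ * (δ * σ⁻¹) ^ 3) * (c⁻¹ * δ ^ 4)⁻¹
  have hαr : Commute α r := h1r.mul_left h2r.inv_left
  have hαu : Commute α u := h1u.mul_left h2u.inv_left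
  have hαp : α p = c p := by
    have := hmul (hcomm h1r h1u) hγ₁ (hinv (hcomm h2r h2u) hγ₂)
    rw [this, show -(k + k) + (k + -l + (k + -l) + (k + -l)) + -(-1 + (k + k + k + k)) =
      1 + 3 * (-(k + l)) by ring, zpow_add, zpow_mul, hc3, one_zpow, zpow_one, mul_one]
  have hαc := hcomm hαr hαu
  refine Equiv.Perm.commutator_ne_of_eq_on_single_cycle (α := α) (p := p) ?_ ?_ hαr hαu hαp.symm ?_
  · intro h
    rw [h] at hαp
    exact hp hαp.symm
  · intro m x hx
    exact Equiv.Perm.eq_of_commute_of_apply_eq htrans (hαr.zpow_left m) (hαu.zpow_left m)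
      (Commute.one_left r) (Commute.one_left u) hx
  · intro x hx
    obtain ⟨m, rfl⟩ := h3.isCycle.exists_pow_eq hp hx
    clear hx
    induction m with
    | zero => exact Equiv.Perm.SameCycle.refl _ _
    | succ m ih =>
      have := DFunLike.congr_fun (hαc.pow_right m).eq p
      simp only [Equiv.Perm.mul_apply] at this
      rw [pow_succ, Equiv.Perm.mul_apply, ← hαp, ← this]
      exact Equiv.Perm.sameCycle_apply_right.2 ih

/-- On a surface with two cone points of angle `4π`, the fourth power of the quarter turn fixes the
four squares with these corners, while it turns once about them. Hence a translation automorphism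
`α` of order two turns once about both cone points; the quotient of the surface by `α` is a torus
in which the images of the cone points are preserved by the shear and the quarter turn. -/
theorem commutator_ne_of_involution
    (htrans : ∀ x y, ∃ g ∈ Subgroup.closure {r, u}, g x = y)
    (hr : MulAut.conj δ r = u⁻¹) (hu : MulAut.conj δ u = u * r * u⁻¹)
    (hσr : MulAut.conj σ r = r) (hσu : MulAut.conj σ u = u * r)
    {c : Equiv.Perm X} (hc : c = u * r * u⁻¹ * r⁻¹) {a b : X} (ha : c a ≠ a) (hb : c b ≠ b)
    (hcc : ∀ x, c (c x) = x) (hab : ¬ c.SameCycle a b)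
    (hS : ∀ x, c x ≠ x → x = a ∨ x = c a ∨ x = b ∨ x = c b) : False := by
  have hcδ := commute_commutator_of_quarterTurn hr hu
  have hcσ := commute_commutator_of_shear hσr hσu
  obtain ⟨h2r, h2u⟩ := quarterTurn_pow_four_commute hr hu
  rw [← hc] at hcδ hcσ h2r h2u
  have happ : ∀ {g : Equiv.Perm X}, Commute g c → ∀ x, g (c x) = c (g x) := fun hg x =>
    DFunLike.congr_fun hg.eq x
  -- permutations commuting with `c` fix or exchange the cycles `{a, c a}` and `{b, c b}`
  have hpair : ∀ {g : Equiv.Perm X}, Commute g c →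
      (g a = a ∨ g a = c a) ∧ (g b = b ∨ g b = c b) ∨
      (g a = b ∨ g a = c b) ∧ (g b = a ∨ g b = c a) := by
    intro g hg
    have hmv : ∀ x, c x ≠ x → c (g x) ≠ g x := fun x hx h => by
      rw [← happ hg] at h; exact hx (g.injective h)
    have hsame : ¬ c.SameCycle (g a) (g b) := fun h => hab (by
      have h' := (Equiv.Perm.sameCycle_conj (f := c) (g := g) (x := g a) (y := g b)).1 (by
        rw [hg.eq, mul_inv_cancel_right]; exact h)
      simpa using h')
    have r1 : ∀ x, c.SameCycle x (c x) := fun x =>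
      Equiv.Perm.sameCycle_apply_right.2 (Equiv.Perm.SameCycle.refl _ _)
    obtain h | h : (g a = a ∨ g a = c a) ∨ (g a = b ∨ g a = c b) := by
      have := hS _ (hmv a ha); tauto
    all_goals
      obtain h' | h' : (g b = a ∨ g b = c a) ∨ (g b = b ∨ g b = c b) := by
        have := hS _ (hmv b hb); tauto
    · refine absurd ?_ hsame
      rcases h with h | h <;> rcases h' with h' | h' <;> rw [h, h']
      exacts [r1 a, (r1 a).symm]
    · exact Or.inl ⟨h, h'⟩
    · exact Or.inr ⟨h, h'⟩
    · refine absurd ?_ hsame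
      rcases h with h | h <;> rcases h' with h' | h' <;> rw [h, h']
      exacts [r1 b, (r1 b).symm]
  have hδ4 : (δ ^ 4) a = a ∧ (δ ^ 4) b = b := by
    simp only [pow_succ, pow_zero, one_mul, Equiv.Perm.mul_apply]
    rcases hpair hcδ with ⟨h | h, h' | h'⟩ | ⟨h | h, h' | h'⟩ <;> simp [h, h', happ hcδ, hcc]
  have hcinv : ∀ x, c⁻¹ x = c x := fun x => by rw [Equiv.Perm.inv_eq_iff_eq, hcc]
  set α : Equiv.Perm X := c⁻¹ * δ ^ 4 with hα
  have hαc : Commute α c := by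
    rw [hc]
    exact ((h2u.mul_right h2r).mul_right h2u.inv_right).mul_right h2r.inv_right
  have hαa : α a = c a := by rw [hα, Equiv.Perm.mul_apply, hδ4.1, hcinv]
  have hαb : α b = c b := by rw [hα, Equiv.Perm.mul_apply, hδ4.2, hcinv]
  have hαS : ∀ x, c x ≠ x → c x = α x := by
    intro x hx
    rcases hS x hx with h | h | h | h <;> simp [h, happ hαc, hαa, hαb]
  have hαδ : Commute α δ := (hcδ.symm.inv_left).mul_left ((Commute.refl δ).pow_left 4)
  have hασ : Commute α σ := by
    have e1 : Commute (MulAut.conj σ α) r := by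
      have := h2r.map (MulAut.conj σ); rwa [hσr] at this
    have e2 : Commute (MulAut.conj σ α) u := by
      have := h2u.map (MulAut.conj σ)
      rw [hσu] at this
      simpa using this.mul_right e1.inv_right
    have e3 : MulAut.conj σ α = α := by
      refine Equiv.Perm.eq_of_commute_of_apply_eq htrans e1 e2 h2r h2u (x := σ a) ?_
      rw [← hαS, ← happ hcσ, ← hαa]
      · simp
      · intro h; rw [← happ hcσ] at h; exact ha (σ.injective h)
    rw [MulAut.conj_apply, mul_inv_eq_iff_eq_mul] at e3
    exact e3.symm
  let C := Subgroup.centralizer {α}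
  have hC : ∀ {g : Equiv.Perm X}, Commute α g → g ∈ C := fun h =>
    Subgroup.mem_centralizer_singleton_iff.2 h.symm
  let r' : C := ⟨r, hC h2r⟩
  let u' : C := ⟨u, hC h2u⟩
  let δ' : C := ⟨δ, hC hαδ⟩
  let σ' : C := ⟨σ, hC hασ⟩
  let F := α.onCycles
  have hmk : ∀ x, Quotient.mk (Equiv.Perm.SameCycle.setoid α) (c x) = Quotient.mk _ x := by
    intro x
    by_cases hx : c x = x
    · rw [hx]
    · rw [hαS x hx]
      exact Quotient.sound (s := Equiv.Perm.SameCycle.setoid α)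
        (Equiv.Perm.sameCycle_apply_left.2 (Equiv.Perm.SameCycle.refl _ _))
  have hone : F u' * F r' * (F u')⁻¹ * (F r')⁻¹ = 1 := by
    rw [← map_inv, ← map_inv, ← map_mul, ← map_mul, ← map_mul]
    ext q
    induction q using Quotient.inductionOn with | _ x => ?_
    rw [Equiv.Perm.onCycles_mk]
    refine Eq.trans ?_ (hmk x)
    rw [hc]; rfl
  have hcomm : Commute (F r') (F u') := by
    rw [mul_inv_eq_one, mul_inv_eq_iff_eq_mul] at hone
    exact hone.symm
  have hclosure : ∀ g ∈ Subgroup.closure {r, u}, ∃ hg : g ∈ C, ∃ i j : ℤ,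
      F ⟨g, hg⟩ = F r' ^ i * F u' ^ j := by
    intro g hg
    induction hg using Subgroup.closure_induction with
    | mem x hx =>
      rcases hx with rfl | rfl
      · exact ⟨r'.2, 1, 0, by simp [r']⟩
      · exact ⟨u'.2, 0, 1, by simp [u']⟩
    | one => exact ⟨C.one_mem, 0, 0, by
        rw [zpow_zero, zpow_zero, mul_one]; exact map_one F⟩
    | mul x y _ _ hx hy =>
      obtain ⟨hx, i, j, e⟩ := hx
      obtain ⟨hy, k, l, e'⟩ := hy
      refine ⟨C.mul_mem hx hy, i + k, j + l, ?_⟩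
      have : F ⟨x * y, C.mul_mem hx hy⟩ = F ⟨x, hx⟩ * F ⟨y, hy⟩ := map_mul F ⟨x, hx⟩ ⟨y, hy⟩
      rw [this, e, e', zpow_add, zpow_add, mul_assoc, mul_assoc, ← mul_assoc (F u' ^ j),
        ← (hcomm.zpow_zpow k j).eq, mul_assoc]
    | inv x _ hx =>
      obtain ⟨hx, i, j, e⟩ := hx
      refine ⟨C.inv_mem hx, -i, -j, ?_⟩
      have : F ⟨x⁻¹, C.inv_mem hx⟩ = (F ⟨x, hx⟩)⁻¹ := map_inv F ⟨x, hx⟩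
      rw [this, e, mul_inv_rev, ← zpow_neg, ← zpow_neg, (hcomm.zpow_zpow (-i) (-j)).eq]
  have hrel : Quotient.mk (Equiv.Perm.SameCycle.setoid α) a = Quotient.mk _ b := by
    refine torus_eq_of_invariant_pair (r := F r') (u := F u') (δ := F δ') (σ := F σ') hcomm
      ?_ ?_ ?_ ?_ ?_ ?_ ?_
    · intro x y
      induction x using Quotient.inductionOn with | _ x => ?_
      induction y using Quotient.inductionOn with | _ y => ?_
      obtain ⟨g, hg, rfl⟩ := htrans x y
      obtain ⟨hg', i, j, e⟩ := hclosure g hg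
      exact ⟨i, j, by rw [← e]; rfl⟩
    · have : δ' * r' * δ'⁻¹ = u'⁻¹ := Subtype.ext hr
      rw [MulAut.conj_apply, ← map_inv, ← map_mul, ← map_mul, this, map_inv]
    · have : δ' * u' * δ'⁻¹ = u' * r' * u'⁻¹ := Subtype.ext hu
      rw [MulAut.conj_apply, ← map_inv, ← map_mul, ← map_mul, this, map_mul, map_mul, map_inv,
        ← hcomm.eq, mul_inv_cancel_right]
    · have : σ' * r' * σ'⁻¹ = r' := Subtype.ext hσr
      rw [MulAut.conj_apply, ← map_inv, ← map_mul, ← map_mul, this]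
    · have : σ' * u' * σ'⁻¹ = u' * r' := Subtype.ext hσu
      rw [MulAut.conj_apply, ← map_inv, ← map_mul, ← map_mul, this, map_mul]
    · simp only [F, Equiv.Perm.onCycles_mk, δ']
      rcases hpair hcδ with ⟨h | h, h' | h'⟩ | ⟨h | h, h' | h'⟩ <;> simp [h, h', hmk]
    · simp only [F, Equiv.Perm.onCycles_mk, σ']
      rcases hpair hcσ with ⟨h | h, h' | h'⟩ | ⟨h | h, h' | h'⟩ <;> simp [h, h', hmk]
  obtain ⟨m, hm⟩ := (Quotient.exact (s := Equiv.Perm.SameCycle.setoid α) hrel).exists_nat_pow_eq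
  refine hab ⟨m, ?_⟩
  rw [zpow_natCast, ← hm]
  clear hm
  induction m with
  | zero => rfl
  | succ m ih =>
    rw [pow_succ', Equiv.Perm.mul_apply, ih, pow_succ, Equiv.Perm.mul_apply, hαa,
      happ (hαc.pow_left m)]

/-- The gluing permutations of a surface of genus two cannot be invariant, up to relabelling the
squares, under both a quarter turn and a horizontal shear. -/
theorem not_quarterTurn_and_shear_invariant
    (htrans : ∀ x y, ∃ g ∈ Subgroup.closure {r, u}, g x = y)
    (hr : MulAut.conj δ r = u⁻¹) (hu : MulAut.conj δ u = u * r * u⁻¹)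
    (hσr : MulAut.conj σ r = r) (hσu : MulAut.conj σ u = u * r) :
    Nat.card (Quotient (Equiv.Perm.SameCycle.setoid (u * r * u⁻¹ * r⁻¹))) + 2 ≠ Fintype.card X := by
  intro h
  rcases Equiv.Perm.isThreeCycle_or_exists_of_card_eq _ h with h3 | ⟨a, b, ha, hb, hcc, hab, hS⟩
  · exact not_isThreeCycle_commutator htrans hr hu hσr hσu h3
  · exact commutator_ne_of_involution htrans hr hu hσr hσu rfl ha hb hcc hab hS

end Permutations

/-! ### Coordinates on the surface and the covering of the torus -/

namespace SquareTiledSurface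

variable {n : ℕ}

open scoped Matrix

/-- The point `(a, b)` of the unit square. -/
def squarePoint (a b : ℝ) (ha : a ∈ Set.Icc 0 1) (hb : b ∈ Set.Icc 0 1) : UnitSquare :=
  ⟨![a, b], by
    constructor <;> intro k <;> fin_cases k <;> simp [ha.1, ha.2, hb.1, hb.2]⟩

@[simp]
theorem squarePoint_zero (a b : ℝ) (ha : a ∈ Set.Icc 0 1) (hb : b ∈ Set.Icc 0 1) :
    (squarePoint a b ha hb).1 0 = a := rfl

@[simp]
theorem squarePoint_one (a b : ℝ) (ha : a ∈ Set.Icc 0 1) (hb : b ∈ Set.Icc 0 1) :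
    (squarePoint a b ha hb).1 1 = b := rfl

theorem unitSquare_mem (x : UnitSquare) (k : Fin 2) : x.1 k ∈ Set.Icc (0 : ℝ) 1 :=
  ⟨x.2.1 k, x.2.2 k⟩

theorem point_right (O : SquareTiledSurface n) (i : Fin n) (x y : UnitSquare) (hx : x.1 0 = 1)
    (hy : y.1 0 = 0) (h : x.1 1 = y.1 1) : O.point (O.right i) y = O.point i x :=
  (Quot.sound (Glue.right i x y hx hy h)).symm

theorem point_up (O : SquareTiledSurface n) (i : Fin n) (x y : UnitSquare) (hx : x.1 1 = 1)
    (hy : y.1 1 = 0) (h : x.1 0 = y.1 0) : O.point (O.up i) y = O.point i x :=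
  (Quot.sound (Glue.up i x y hx hy h)).symm

/-- A point in the interior of a square belongs to no other square. -/
theorem eq_of_point_eq_of_interior (O : SquareTiledSurface n) {i j : Fin n} {x y : UnitSquare}
    (hx : ∀ k, x.1 k ∈ Set.Ioo (0 : ℝ) 1) (h : O.point i x = O.point j y) : i = j := by
  let P : O.Surface → Prop := Quot.lift (fun z => z = (i, x)) (by
    rintro _ _ (⟨i', a, b, ha, hb, -⟩ | ⟨i', a, b, ha, hb, -⟩)
    all_goals
      refine propext ⟨fun e => ?_, fun e => ?_⟩ <;> obtain ⟨-, rfl⟩ := Prod.ext_iff.1 e <;>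
        dsimp only at *
    · exact absurd ha (hx 0).2.ne
    · exact absurd hb (hx 0).1.ne'
    · exact absurd ha (hx 1).2.ne
    · exact absurd hb (hx 1).1.ne')
  have h1 : P (O.point i x) := (rfl : ((i, x) : Fin n × UnitSquare) = (i, x))
  rw [h] at h1
  have h2 : ((j, y) : Fin n × UnitSquare) = (i, x) := h1
  exact (Prod.ext_iff.1 h2).1.symm

/-- Points on the sides of squares can be represented in squares on either side: every point of the
surface has a representative off the right or the left sides, as prescribed by `s 0`, and off the
top or the bottom sides, as prescribed by `s 1`. -/
theorem exists_point_eq_off_sides (O : SquareTiledSurface n) (s : Fin 2 → Prop) (p : O.Surface) :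
    ∃ (j : Fin n) (y : UnitSquare), O.point j y = p ∧
      ∀ k, (s k → y.1 k < 1) ∧ (¬ s k → 0 < y.1 k) := by
  have h0 : ∃ (j : Fin n) (y : UnitSquare), O.point j y = p ∧
      (s 0 → y.1 0 < 1) ∧ (¬ s 0 → 0 < y.1 0) := by
    obtain ⟨⟨j, y⟩, rfl⟩ := Quot.exists_rep p
    by_cases hs : s 0
    · rcases (unitSquare_mem y 0).2.lt_or_eq with h | h
      · exact ⟨j, y, rfl, fun _ => h, fun h' => absurd hs h'⟩
      · exact ⟨O.right j, squarePoint 0 (y.1 1) (by simp) (unitSquare_mem y 1),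
          O.point_right j y _ h rfl rfl, fun _ => zero_lt_one, fun h' => absurd hs h'⟩
    · rcases (unitSquare_mem y 0).1.lt_or_eq with h | h
      · exact ⟨j, y, rfl, fun h' => absurd h' hs, fun _ => h⟩
      · refine ⟨O.right⁻¹ j, squarePoint 1 (y.1 1) (by simp) (unitSquare_mem y 1), ?_,
          fun h' => absurd h' hs, fun _ => zero_lt_one⟩
        have := O.point_right (O.right⁻¹ j) (squarePoint 1 (y.1 1) (by simp) (unitSquare_mem y 1))
          y rfl h.symm rfl
        rw [show O.right (O.right⁻¹ j) = j from O.right.apply_symm_apply j] at this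
        exact this.symm
  obtain ⟨j, y, rfl, h0⟩ := h0
  simp only [Fin.forall_fin_two]
  by_cases hs : s 1
  · rcases (unitSquare_mem y 1).2.lt_or_eq with h | h
    · exact ⟨j, y, rfl, h0, fun _ => h, fun h' => absurd hs h'⟩
    · exact ⟨O.up j, squarePoint (y.1 0) 0 (unitSquare_mem y 0) (by simp),
        O.point_up j y _ h rfl rfl, h0, fun _ => zero_lt_one, fun h' => absurd hs h'⟩
  · rcases (unitSquare_mem y 1).1.lt_or_eq with h | h
    · exact ⟨j, y, rfl, h0, fun h' => absurd h' hs, fun _ => h⟩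
    · refine ⟨O.up⁻¹ j, squarePoint (y.1 0) 1 (unitSquare_mem y 0) (by simp), ?_, h0,
        fun h' => absurd h' hs, fun _ => zero_lt_one⟩
      have := O.point_up (O.up⁻¹ j) (squarePoint (y.1 0) 1 (unitSquare_mem y 0) (by simp))
        y rfl h.symm rfl
      rw [show O.up (O.up⁻¹ j) = j from O.up.apply_symm_apply j] at this
      exact this.symm

/-- The covering of the torus `(ℝ / ℤ)²` by the surface: coordinates in the squares modulo `1`. -/
def toTorus (O : SquareTiledSurface n) : O.Surface → Fin 2 → UnitAddCircle :=
  Quot.lift (fun z k => ((z.2.1 k : ℝ) : UnitAddCircle)) (by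
    have h10 : ((1 : ℝ) : UnitAddCircle) = ((0 : ℝ) : UnitAddCircle) := by
      rw [AddCircle.coe_period]; rfl
    rintro _ _ (⟨i, x, y, hx, hy, h⟩ | ⟨i, x, y, hx, hy, h⟩) <;> funext k <;> fin_cases k
    · simp [hx, hy]
    · simp [h]
    · simp [h]
    · simp [hx, hy])

theorem toTorus_point (O : SquareTiledSurface n) (i : Fin n) (x : UnitSquare) (k : Fin 2) :
    O.toTorus (O.point i x) k = (x.1 k : UnitAddCircle) := rfl

theorem continuous_point (O : SquareTiledSurface n) (i : Fin n) : Continuous (O.point i) :=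
  continuous_quot_mk.comp (by fun_prop)

theorem continuous_toTorus (O : SquareTiledSurface n) : Continuous O.toTorus := by
  refine continuous_quot_lift _ ?_
  refine continuous_pi fun k => ?_
  exact (AddCircle.continuous_mk' 1).comp
    ((continuous_apply k).comp (continuous_subtype_val.comp continuous_snd))

theorem toTorus_eq_zero_of_mem_conePoints (O : SquareTiledSurface n) {p : O.Surface}
    (hp : p ∈ O.conePoints) : O.toTorus p = 0 := by
  obtain ⟨i, x, hx, -, rfl⟩ := hp
  funext k
  rw [toTorus_point, hx]
  rfl

/-- The integral affine map of the plane with linear part `A` and translation part `b`. -/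
def affineMap (A : Matrix (Fin 2) (Fin 2) ℤ) (b : Fin 2 → ℤ) (x : Fin 2 → ℝ) : Fin 2 → ℝ :=
  fun k => A k 0 * x 0 + A k 1 * x 1 + b k

theorem continuous_affineMap (A : Matrix (Fin 2) (Fin 2) ℤ) (b : Fin 2 → ℤ) :
    Continuous (affineMap A b) := by
  unfold affineMap; fun_prop

theorem affineMap_sub (A : Matrix (Fin 2) (Fin 2) ℤ) (b : Fin 2 → ℤ) (x y : Fin 2 → ℝ) :
    affineMap A b x - affineMap A b y = A.map (Int.castRingHom ℝ) *ᵥ (x - y) := by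
  funext k
  simp [affineMap, Matrix.mulVec, dotProduct, Fin.sum_univ_two]
  ring

/-- The endomorphism of the torus `(ℝ / ℤ)²` given by the integral matrix `A`. -/
def torusMap (A : Matrix (Fin 2) (Fin 2) ℤ) (θ : Fin 2 → UnitAddCircle) : Fin 2 → UnitAddCircle :=
  fun k => A k 0 • θ 0 + A k 1 • θ 1

theorem continuous_torusMap (A : Matrix (Fin 2) (Fin 2) ℤ) : Continuous (torusMap A) := by
  unfold torusMap
  refine continuous_pi fun k => ?_
  exact ((continuous_apply 0).zsmul _).add ((continuous_apply 1).zsmul _)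

theorem coe_affineMap (A : Matrix (Fin 2) (Fin 2) ℤ) (b : Fin 2 → ℤ) (x : Fin 2 → ℝ) (k : Fin 2) :
    (affineMap A b x k : UnitAddCircle) = torusMap A (fun l => (x l : UnitAddCircle)) k := by
  have hb : ((b k : ℝ) : UnitAddCircle) = 0 :=
    (AddCircle.coe_eq_zero_iff 1).2 ⟨b k, by simp⟩
  simp only [affineMap, torusMap, AddCircle.coe_add, hb, add_zero, ← zsmul_eq_mul,
    AddCircle.coe_zsmul]

/-- The part of the open unit square which is mapped to the open unit square. -/
def overlap (A : Matrix (Fin 2) (Fin 2) ℤ) (b : Fin 2 → ℤ) : Set UnitSquare :=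
  {x | (∀ k, x.1 k ∈ Set.Ioo (0 : ℝ) 1) ∧ ∀ k, affineMap A b x.1 k ∈ Set.Ioo (0 : ℝ) 1}

theorem affineMap_combo (A : Matrix (Fin 2) (Fin 2) ℤ) (b : Fin 2 → ℤ) (x y : Fin 2 → ℝ) {s t : ℝ}
    (hst : s + t = 1) : affineMap A b (s • x + t • y) = s • affineMap A b x + t • affineMap A b y := by
  funext k
  simp only [affineMap, Pi.add_apply, Pi.smul_apply, smul_eq_mul]
  linear_combination (b k : ℝ) * (- hst)

theorem isPreconnected_overlap (A : Matrix (Fin 2) (Fin 2) ℤ) (b : Fin 2 → ℤ) :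
    IsPreconnected (overlap A b) := by
  rw [← Topology.IsInducing.subtypeVal.isPreconnected_image]
  refine Convex.isPreconnected ?_
  have : (Subtype.val '' overlap A b : Set (Fin 2 → ℝ)) =
      {x | (∀ k, x k ∈ Set.Ioo (0 : ℝ) 1) ∧ ∀ k, affineMap A b x k ∈ Set.Ioo (0 : ℝ) 1} := by
    ext x
    constructor
    · rintro ⟨y, hy, rfl⟩; exact hy
    · intro hx
      exact ⟨⟨x, fun k => (hx.1 k).1.le, fun k => (hx.1 k).2.le⟩, hx, rfl⟩
  rw [this]
  intro x hx y hy s t hs ht hst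
  refine ⟨fun k => ?_, fun k => ?_⟩
  · exact convex_Ioo (0 : ℝ) 1 (hx.1 k) (hy.1 k) hs ht hst
  · rw [affineMap_combo A b x y hst]
    exact convex_Ioo (0 : ℝ) 1 (hx.2 k) (hy.2 k) hs ht hst

theorem mem_closure_overlap (A : Matrix (Fin 2) (Fin 2) ℤ) (b : Fin 2 → ℤ) {c x : UnitSquare}
    (hc : c ∈ overlap A b) (hx : ∀ k, affineMap A b x.1 k ∈ Set.Icc (0 : ℝ) 1) :
    x ∈ closure (overlap A b) := by
  let ψ : unitInterval → UnitSquare := fun t => ⟨(1 - t.1) • x.1 + t.1 • c.1,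
    convex_Icc (0 : Fin 2 → ℝ) 1 x.2 c.2 (by linarith [t.2.2]) t.2.1 (by ring)⟩
  have hψ : Continuous ψ := by
    refine Continuous.subtype_mk ?_ _
    fun_prop
  have h0 : ψ 0 = x := Subtype.ext (by simp [ψ])
  have hmem : (0 : unitInterval) ∈ closure (Set.Ioi (0 : unitInterval)) := by
    rw [closure_Ioi' ⟨1, by simp⟩]; simp
  have key : ∀ {a d t : ℝ}, a ∈ Set.Icc (0 : ℝ) 1 → d ∈ Set.Ioo (0 : ℝ) 1 → 0 < t → t ≤ 1 →
      (1 - t) • a + t • d ∈ Set.Ioo (0 : ℝ) 1 := by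
    intro a d t ha hd h0 h1
    simp only [smul_eq_mul]
    have e1 : 0 ≤ (1 - t) * a := mul_nonneg (by linarith) ha.1
    have e2 : 0 < t * d := mul_pos h0 hd.1
    have e3 : (1 - t) * a ≤ (1 - t) * 1 := mul_le_mul_of_nonneg_left ha.2 (by linarith)
    have e4 : t * d < t * 1 := mul_lt_mul_of_pos_left hd.2 h0
    exact ⟨by linarith, by linarith⟩
  rw [← h0]
  refine map_mem_closure hψ hmem fun t ht => ?_
  have ht0 : 0 < t.1 := ht
  refine ⟨fun k => key (unitSquare_mem x k) (hc.1 k) ht0 t.2.2, fun k => ?_⟩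
  have : affineMap A b (ψ t).1 = _ := affineMap_combo A b x.1 c.1 (by ring : (1 - t.1) + t.1 = 1)
  rw [this]
  exact key (hx k) (hc.2 k) ht0 t.2.2

section Affine

variable {O : SquareTiledSurface n} {A : Matrix (Fin 2) (Fin 2) ℤ} {f : O.Surface ≃ₜ O.Surface}

theorem not_mem_conePoints (O : SquareTiledSurface n) {i : Fin n} {x : UnitSquare}
    (hx : ∃ k, x.1 k ∈ Set.Ioo (0 : ℝ) 1) : O.point i x ∉ O.conePoints := by
  intro h
  obtain ⟨k, h0, h1⟩ := hx
  have := congr_fun (O.toTorus_eq_zero_of_mem_conePoints h) k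
  rw [toTorus_point] at this
  obtain ⟨m, hm⟩ := (AddCircle.coe_eq_zero_iff 1).1 this
  simp only [zsmul_eq_mul, mul_one] at hm
  rw [← hm] at h0 h1
  norm_cast at h0 h1
  omega

/-- Away from the cone points, an affine homeomorphism with integral linear part `A` differs from
the linear map `A` by a locally constant translation, when seen in the torus. -/
theorem IsAffine.eventually_toTorus_eq (hf : O.IsAffine (A.map (Int.castRingHom ℝ)) f) {i : Fin n}
    {x : UnitSquare} (hx : O.point i x ∉ O.conePoints) :
    ∀ᶠ x' in nhds x, O.toTorus (f (O.point i x')) - torusMap A (O.toTorus (O.point i x')) =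
      O.toTorus (f (O.point i x)) - torusMap A (O.toTorus (O.point i x)) := by
  choose J Y hY hs using fun s => O.exists_point_eq_off_sides s (f (O.point i x))
  have h1 : ∀ᶠ x' in nhds x, ∀ s, ∀ y' : UnitSquare,
      y'.1 - (Y s).1 = A.map (Int.castRingHom ℝ) *ᵥ (x'.1 - x.1) →
      f (O.point i x') = O.point (J s) y' :=
    Filter.eventually_all.2 fun s => hf.2 i x (J s) (Y s) hx (hY s).symm
  have hd : ∀ k, Filter.Tendsto (fun x' : UnitSquare => affineMap A 0 x'.1 k - affineMap A 0 x.1 k)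
      (nhds x) (nhds 0) := fun k => by
    have : Continuous fun x' : UnitSquare => affineMap A 0 x'.1 k - affineMap A 0 x.1 k :=
      ((continuous_apply k).comp ((continuous_affineMap A 0).comp continuous_subtype_val)).sub
        continuous_const
    simpa using this.tendsto x
  have h2 : ∀ᶠ x' in nhds x, ∀ (s : Fin 2 → Prop) k,
      (s k → affineMap A 0 x'.1 k - affineMap A 0 x.1 k < 1 - (Y s).1 k) ∧
      (¬ s k → - (Y s).1 k < affineMap A 0 x'.1 k - affineMap A 0 x.1 k) := by
    refine Filter.eventually_all.2 fun s => Filter.eventually_all.2 fun k => ?_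
    by_cases h : s k
    · filter_upwards [(hd k).eventually_lt_const (sub_pos.2 ((hs s k).1 h))] with x' hx'
      exact ⟨fun _ => hx', fun h' => absurd h h'⟩
    · filter_upwards [(hd k).eventually_const_lt (neg_neg_iff_pos.2 ((hs s k).2 h))] with x' hx'
      exact ⟨fun h' => absurd h' h, fun _ => hx'⟩
  filter_upwards [h1, h2] with x' h1 h2
  -- the square in which the image is read is chosen by the direction of the displacement
  let s : Fin 2 → Prop := fun k => 0 ≤ affineMap A 0 x'.1 k - affineMap A 0 x.1 k
  let y' : UnitSquare := ⟨(Y s).1 + (affineMap A 0 x'.1 - affineMap A 0 x.1), by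
    refine ⟨fun k => ?_, fun k => ?_⟩ <;> have e := h2 s k <;>
      have e' := unitSquare_mem (Y s) k <;>
      simp only [Pi.add_apply, Pi.sub_apply, Pi.zero_apply, Pi.one_apply] <;>
      by_cases h : s k
    · have : 0 ≤ affineMap A 0 x'.1 k - affineMap A 0 x.1 k := h
      linarith [e'.1]
    · linarith [e.2 h]
    · linarith [e.1 h]
    · have : ¬ 0 ≤ affineMap A 0 x'.1 k - affineMap A 0 x.1 k := h
      linarith [e'.2]⟩
  have h3 := h1 s y' (by rw [← affineMap_sub A 0]; simp [y'])
  funext k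
  rw [Pi.sub_apply, Pi.sub_apply, h3, ← hY s]
  have e1 := coe_affineMap A 0 x'.1 k
  have e2 := coe_affineMap A 0 x.1 k
  have e3 : torusMap A (O.toTorus (O.point i x')) k = affineMap A 0 x'.1 k := e1.symm
  have e4 : torusMap A (O.toTorus (O.point i x)) k = affineMap A 0 x.1 k := e2.symm
  rw [e3, e4, toTorus_point, toTorus_point]
  simp only [y', Pi.add_apply, Pi.sub_apply, AddCircle.coe_add, AddCircle.coe_sub]
  abel

end Affine

end SquareTiledSurface

/-! ### Affine homeomorphisms with integral linear part -/

namespace SquareTiledSurface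

variable {n : ℕ}

open scoped Matrix

section Affine

variable {O : SquareTiledSurface n} {A : Matrix (Fin 2) (Fin 2) ℤ} {f : O.Surface ≃ₜ O.Surface}

/-- An affine homeomorphism of a surface with cone points covers an endomorphism of the torus: the
difference is constant on each square, adjacent squares share points, and the difference vanishes
at the cone points. -/
theorem IsAffine.toTorus_apply (hf : O.IsAffine (A.map (Int.castRingHom ℝ)) f)
    (hO : O.conePoints.Nonempty) (p : O.Surface) : O.toTorus (f p) = torusMap A (O.toTorus p) := by
  let φ : O.Surface → Fin 2 → UnitAddCircle := fun p => O.toTorus (f p) - torusMap A (O.toTorus p)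
  have hφ : Continuous φ := (O.continuous_toTorus.comp f.continuous).sub
    ((continuous_torusMap A).comp O.continuous_toTorus)
  let c : UnitSquare := squarePoint (1 / 2) (1 / 2) (by norm_num) (by norm_num)
  have hc : c ∈ overlap 1 0 := by
    simp [overlap, Fin.forall_fin_two, affineMap, c]; norm_num
  have hsq : ∀ i x, φ (O.point i x) = φ (O.point i c) := by
    intro i x
    have hx : x ∈ closure (overlap 1 0) := mem_closure_overlap 1 0 hc fun k => by
      have hid : affineMap 1 0 x.1 = x.1 :=
        funext (Fin.forall_fin_two.2 ⟨by simp [affineMap], by simp [affineMap]⟩)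
      rw [hid]; exact unitSquare_mem x k
    have hcl : IsClosed {x | φ (O.point i x) = φ (O.point i c)} :=
      isClosed_eq (hφ.comp (O.continuous_point i)) continuous_const
    refine closure_minimal ?_ hcl hx
    intro x hx
    refine (isPreconnected_overlap 1 0).induction₂
      (fun x y => φ (O.point i x) = φ (O.point i y)) ?_ ?_ ?_ hx hc
    · intro x hx
      have := hf.eventually_toTorus_eq (O.not_mem_conePoints (i := i) ⟨0, hx.1 0⟩)
      exact (this.filter_mono nhdsWithin_le_nhds).mono fun y hy => hy.symm
    · intro x y z _ _ _ h1 h2; exact h1.trans h2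
    · intro x y _ _ h; exact h.symm
  have hright : ∀ i, φ (O.point (O.right i) c) = φ (O.point i c) := fun i => by
    have := O.point_right i (squarePoint 1 0 (by simp) (by simp))
      (squarePoint 0 0 (by simp) (by simp)) rfl rfl rfl
    rw [← hsq (O.right i), this, hsq]
  have hup : ∀ i, φ (O.point (O.up i) c) = φ (O.point i c) := fun i => by
    have := O.point_up i (squarePoint 0 1 (by simp) (by simp))
      (squarePoint 0 0 (by simp) (by simp)) rfl rfl rfl
    rw [← hsq (O.up i), this, hsq]
  have hconst : ∀ i j, φ (O.point i c) = φ (O.point j c) := by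
    intro i j
    obtain ⟨g, hg, rfl⟩ := O.connected i j
    induction hg using Subgroup.closure_induction generalizing i with
    | mem x hx =>
      rcases hx with rfl | rfl
      · exact (hright i).symm
      · exact (hup i).symm
    | one => rfl
    | mul x y _ _ hx hy => exact (hy i).trans (hx (y i))
    | inv x _ hx =>
      rw [hx (x⁻¹ i), show x (x⁻¹ i) = i from x.apply_symm_apply i]
  obtain ⟨q, hq⟩ := hO
  have hq0 : φ q = 0 := by
    have hfq : f q ∈ O.conePoints := by rw [← hf.1]; exact Set.mem_image_of_mem _ hq
    simp only [φ, O.toTorus_eq_zero_of_mem_conePoints hq,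
      O.toTorus_eq_zero_of_mem_conePoints hfq]
    funext k
    simp [torusMap]
  obtain ⟨⟨i, x⟩, rfl⟩ := Quot.exists_rep q
  obtain ⟨⟨j, y⟩, rfl⟩ := Quot.exists_rep p
  have h1 : φ (O.point j y) = 0 := by rw [hsq, hconst j i, ← hsq i x]; exact hq0
  exact sub_eq_zero.1 h1

/-- The image under `f` of the point `x` of the square `i` is the point `A x + b` of the
square `j`. -/
def LandsIn (A : Matrix (Fin 2) (Fin 2) ℤ) (f : O.Surface ≃ₜ O.Surface) (b : Fin 2 → ℤ)
    (i : Fin n) (x : UnitSquare) (j : Fin n) : Prop :=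
  ∃ y : UnitSquare, y.1 = affineMap A b x.1 ∧ f (O.point i x) = O.point j y

/-- The coordinates of the image are known modulo `1`; where they are `0` or `1`, the square in which
they are read is chosen on the side prescribed by `A x + b`. -/
theorem IsAffine.exists_landsIn (hf : O.IsAffine (A.map (Int.castRingHom ℝ)) f)
    (hO : O.conePoints.Nonempty) {b : Fin 2 → ℤ} (i : Fin n) {x : UnitSquare}
    (hx : ∀ k, affineMap A b x.1 k ∈ Set.Icc (0 : ℝ) 1) : ∃ j, LandsIn A f b i x j := by
  obtain ⟨j, y, hy, h⟩ :=
    O.exists_point_eq_off_sides (fun k => affineMap A b x.1 k < 1) (f (O.point i x))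
  refine ⟨j, y, ?_, hy.symm⟩
  funext k
  have h1 := congr_fun (hf.toTorus_apply hO (O.point i x)) k
  rw [← hy, toTorus_point] at h1
  have h2 : (y.1 k : UnitAddCircle) = affineMap A b x.1 k := by
    rw [h1, coe_affineMap]; rfl
  rw [← sub_eq_zero, ← AddCircle.coe_sub] at h2
  obtain ⟨m, hm⟩ := (AddCircle.coe_eq_zero_iff 1).1 h2
  simp only [zsmul_eq_mul, mul_one] at hm
  have hy' := unitSquare_mem y k
  have hx' := hx k
  have hm0 : m = 0 := by
    by_cases hlt : affineMap A b x.1 k < 1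
    · have := (h k).1 hlt
      have h3 : (m : ℝ) < 1 := by rw [hm]; linarith [hx'.1]
      have h4 : (-1 : ℝ) < m := by rw [hm]; linarith [hy'.1]
      norm_cast at h3 h4
      omega
    · have := (h k).2 hlt
      have h3 : (m : ℝ) < 1 := by rw [hm]; linarith [hy'.2]
      have h4 : (-1 : ℝ) < m := by rw [hm]; linarith [hx'.2]
      norm_cast at h3 h4
      omega
  rw [hm0] at hm
  push_cast at hm
  linarith

/-- Near a point which is not a cone point, images do not jump from one square to another. -/
theorem IsAffine.eventually_landsIn (hf : O.IsAffine (A.map (Int.castRingHom ℝ)) f)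
    {b : Fin 2 → ℤ} {i j : Fin n} {x : UnitSquare} (hx : O.point i x ∉ O.conePoints)
    (h : LandsIn A f b i x j) : ∀ᶠ x' in nhds x, x' ∈ overlap A b → LandsIn A f b i x' j := by
  obtain ⟨y, hy, hfy⟩ := h
  filter_upwards [hf.2 i x j y hx hfy] with x' h hx'
  refine ⟨⟨affineMap A b x'.1, fun k => (hx'.2 k).1.le, fun k => (hx'.2 k).2.le⟩, rfl, h _ ?_⟩
  rw [hy, affineMap_sub]

theorem landsIn_unique {b : Fin 2 → ℤ} {i j j' : Fin n} {x : UnitSquare} (hx : x ∈ overlap A b)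
    (h : LandsIn A f b i x j) (h' : LandsIn A f b i x j') : j = j' := by
  obtain ⟨y, hy, hfy⟩ := h
  obtain ⟨y', -, hfy'⟩ := h'
  exact O.eq_of_point_eq_of_interior (by rw [hy]; exact hx.2) (hfy.symm.trans hfy')

/-- The points of a square which `x ↦ A x + b` maps to the closed unit square all land in the same
square, the one in which the interior point `c` lands. At boundary points this needs the point to be
off the corners, where the condition on affine maps may be void. -/
theorem IsAffine.landsIn_eq (hf : O.IsAffine (A.map (Int.castRingHom ℝ)) f)
    (hO : O.conePoints.Nonempty) {b : Fin 2 → ℤ} {c : UnitSquare} (hc : c ∈ overlap A b)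
    {i j j' : Fin n} {x : UnitSquare} (hx : ∃ k, x.1 k ∈ Set.Ioo (0 : ℝ) 1)
    (h : LandsIn A f b i x j) (h' : LandsIn A f b i c j') : j = j' := by
  have hex : ∀ y ∈ overlap A b, ∃ j, LandsIn A f b i y j := fun y hy =>
    hf.exists_landsIn hO i fun k => Set.Ioo_subset_Icc_self (hy.2 k)
  have hxcl : x ∈ closure (overlap A b) := by
    obtain ⟨y, hy, -⟩ := h
    exact mem_closure_overlap A b hc fun k => by rw [← hy]; exact unitSquare_mem y k
  have hev := hf.eventually_landsIn (O.not_mem_conePoints (i := i) hx) h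
  obtain ⟨z, hz, hzU⟩ := (mem_closure_iff_frequently.1 hxcl).and_eventually hev |>.exists
  refine landsIn_unique hc ?_ h'
  refine (isPreconnected_overlap A b).induction₂
    (fun x y => ∀ j, LandsIn A f b i x j → LandsIn A f b i y j) ?_ ?_ ?_ hz hc j (hzU hz)
  · intro x hx
    obtain ⟨j, hj⟩ := hex x hx
    have := hf.eventually_landsIn (O.not_mem_conePoints (i := i) ⟨0, hx.1 0⟩) hj
    filter_upwards [this.filter_mono nhdsWithin_le_nhds, self_mem_nhdsWithin] with y hy hyU j' hj'
    rw [landsIn_unique hx hj' hj]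
    exact hy hyU
  · intro x y z _ _ _ h1 h2 j hj; exact h2 j (h1 j hj)
  · intro x y hx _ hxy j hj
    obtain ⟨j', hj'⟩ := hex x hx
    rw [landsIn_unique ‹_› hj (hxy j' hj')]
    exact hj'

theorem landsIn_injective {b : Fin 2 → ℤ} {i i' j : Fin n} {c : UnitSquare} (hc : c ∈ overlap A b)
    (h : LandsIn A f b i c j) (h' : LandsIn A f b i' c j) : i = i' := by
  obtain ⟨y, hy, hfy⟩ := h
  obtain ⟨y', hy', hfy'⟩ := h'
  obtain rfl : y = y' := Subtype.ext (hy.trans hy'.symm)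
  exact O.eq_of_point_eq_of_interior hc.1 (f.injective (hfy.trans hfy'.symm))

/-- The permutation of the squares induced by `f`, as seen from the points `c` of the squares. -/
theorem IsAffine.exists_perm (hf : O.IsAffine (A.map (Int.castRingHom ℝ)) f)
    (hO : O.conePoints.Nonempty) {b : Fin 2 → ℤ} {c : UnitSquare} (hc : c ∈ overlap A b) :
    ∃ σ : Equiv.Perm (Fin n), ∀ i, LandsIn A f b i c (σ i) := by
  choose σ hσ using fun i => hf.exists_landsIn hO (b := b) i (x := c)
    fun k => Set.Ioo_subset_Icc_self (hc.2 k)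
  have hinj : Function.Injective σ := fun i i' h =>
    landsIn_injective hc (hσ i) (h ▸ hσ i')
  exact ⟨Equiv.ofBijective σ (Finite.injective_iff_bijective.1 hinj), hσ⟩

theorem LandsIn.of_eq {b b' : Fin 2 → ℤ} {i i' j j' : Fin n} {x x' : UnitSquare}
    (h : LandsIn A f b i x j) (hx : O.point i' x' = O.point i x) {y' : UnitSquare}
    (hy' : y'.1 = affineMap A b' x'.1)
    (hy : ∀ y : UnitSquare, y.1 = affineMap A b x.1 → O.point j' y' = O.point j y) :
    LandsIn A f b' i' x' j' := by
  obtain ⟨y, hy1, hy2⟩ := h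
  exact ⟨y', hy', by rw [hx, hy2, hy y hy1]⟩

end Affine

end SquareTiledSurface

/-! ### The quarter turn, the shear, and genus two -/

namespace SquareTiledSurface

variable {n : ℕ} {O : SquareTiledSurface n} {f : O.Surface ≃ₜ O.Surface}

/-- An affine homeomorphism whose linear part is the quarter turn maps squares to squares, right
sides to top sides and top sides to left sides. -/
theorem exists_perm_of_isAffine_quarterTurn
    (hf : O.IsAffine ((!![0, -1; 1, 0] : Matrix (Fin 2) (Fin 2) ℤ).map (Int.castRingHom ℝ)) f)
    (hO : O.conePoints.Nonempty) :
    ∃ τ : Equiv.Perm (Fin n), (∀ i, τ (O.right i) = O.up (τ i)) ∧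
      ∀ i, O.right (τ (O.up i)) = τ i := by
  have hhalf : (1 / 2 : ℝ) ∈ Set.Icc (0 : ℝ) 1 := by norm_num
  have h0 : (0 : ℝ) ∈ Set.Icc (0 : ℝ) 1 := by simp
  have h1 : (1 : ℝ) ∈ Set.Icc (0 : ℝ) 1 := by simp
  have hIoo : (1 / 2 : ℝ) ∈ Set.Ioo (0 : ℝ) 1 := by norm_num
  have hc : squarePoint (1 / 2) (1 / 2) hhalf hhalf ∈ overlap !![0, -1; 1, 0] ![1, 0] := by
    simp [overlap, Fin.forall_fin_two, affineMap]; norm_num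
  obtain ⟨τ, hτ⟩ := hf.exists_perm hO hc
  refine ⟨τ, fun i => ?_, fun i => ?_⟩
  · obtain ⟨j, hj⟩ := hf.exists_landsIn hO (b := ![1, 0]) i (x := squarePoint 1 (1 / 2) h1 hhalf)
      (by simp [Fin.forall_fin_two, affineMap]; norm_num)
    obtain rfl := hf.landsIn_eq hO hc ⟨1, hIoo⟩ hj (hτ i)
    refine (hf.landsIn_eq hO hc (x := squarePoint 0 (1 / 2) h0 hhalf) ⟨1, hIoo⟩ ?_
      (hτ (O.right i))).symm
    refine hj.of_eq (O.point_right i _ _ rfl rfl rfl) (y' := squarePoint (1 / 2) 0 hhalf h0)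
      (funext (Fin.forall_fin_two.2 ⟨?_, ?_⟩)) fun y hy => O.point_up _ _ _ ?_ rfl ?_
    · simp [affineMap]; norm_num
    · simp [affineMap]
    · rw [hy]; simp [affineMap]
    · rw [hy]; simp [affineMap]; norm_num
  · obtain ⟨j, hj⟩ := hf.exists_landsIn hO (b := ![1, 0]) (O.up i)
      (x := squarePoint (1 / 2) 0 hhalf h0)
      (by simp [Fin.forall_fin_two, affineMap]; norm_num)
    obtain rfl := hf.landsIn_eq hO hc ⟨0, hIoo⟩ hj (hτ (O.up i))
    refine hf.landsIn_eq hO hc (x := squarePoint (1 / 2) 1 hhalf h1) ⟨0, hIoo⟩ ?_ (hτ i)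
    refine hj.of_eq (O.point_up i (squarePoint (1 / 2) 1 hhalf h1)
      (squarePoint (1 / 2) 0 hhalf h0) rfl rfl rfl).symm (y' := squarePoint 0 (1 / 2) h0 hhalf)
      (funext (Fin.forall_fin_two.2 ⟨?_, ?_⟩)) fun y hy => O.point_right _ _ _ ?_ rfl ?_
    · simp [affineMap]
    · simp [affineMap]
    · rw [hy]; simp [affineMap]
    · rw [hy]; simp [affineMap]

/-- An affine homeomorphism whose linear part is the horizontal shear maps the lower left half of
the square `i` to the square `σ i` and its upper right half to the square `right (σ i)`. -/
theorem exists_perm_of_isAffine_shear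
    (hf : O.IsAffine ((!![1, 1; 0, 1] : Matrix (Fin 2) (Fin 2) ℤ).map (Int.castRingHom ℝ)) f)
    (hO : O.conePoints.Nonempty) :
    ∃ σ : Equiv.Perm (Fin n), (∀ i, σ (O.right i) = O.right (σ i)) ∧
      ∀ i, σ (O.up i) = O.up (O.right (σ i)) := by
  have hhalf : (1 / 2 : ℝ) ∈ Set.Icc (0 : ℝ) 1 := by norm_num
  have h0 : (0 : ℝ) ∈ Set.Icc (0 : ℝ) 1 := by simp
  have h1 : (1 : ℝ) ∈ Set.Icc (0 : ℝ) 1 := by simp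
  have hIoo : (1 / 2 : ℝ) ∈ Set.Ioo (0 : ℝ) 1 := by norm_num
  -- a point in the lower left half and a point in the upper right half of a square
  have hc : squarePoint (1 / 4) (1 / 2) (by norm_num) hhalf ∈ overlap !![1, 1; 0, 1] ![0, 0] := by
    simp [overlap, Fin.forall_fin_two, affineMap]; norm_num
  have hd : squarePoint (3 / 4) (1 / 2) (by norm_num) hhalf ∈ overlap !![1, 1; 0, 1] ![-1, 0] := by
    simp [overlap, Fin.forall_fin_two, affineMap]; norm_num
  obtain ⟨σ, hσ⟩ := hf.exists_perm hO hc
  obtain ⟨ρ, hρ⟩ := hf.exists_perm hO hd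
  -- crossing the diagonal of the square `i`
  have hdiag : ∀ i, O.right (σ i) = ρ i := fun i => by
    obtain ⟨j, hj⟩ := hf.exists_landsIn hO (b := ![0, 0]) i
      (x := squarePoint (1 / 2) (1 / 2) hhalf hhalf)
      (by simp [Fin.forall_fin_two, affineMap]; norm_num)
    obtain rfl := hf.landsIn_eq hO hc ⟨0, hIoo⟩ hj (hσ i)
    refine hf.landsIn_eq hO hd (x := squarePoint (1 / 2) (1 / 2) hhalf hhalf) ⟨0, hIoo⟩ ?_ (hρ i)
    refine hj.of_eq rfl (y' := squarePoint 0 (1 / 2) h0 hhalf)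
      (funext (Fin.forall_fin_two.2 ⟨?_, ?_⟩)) fun y hy => O.point_right _ _ _ ?_ rfl ?_
    · simp [affineMap]; norm_num
    · simp [affineMap]
    · rw [hy]; simp [affineMap]; norm_num
    · rw [hy]; simp [affineMap]
  have hright : ∀ i, ρ i = σ (O.right i) := fun i => by
    obtain ⟨j, hj⟩ := hf.exists_landsIn hO (b := ![-1, 0]) i
      (x := squarePoint 1 (1 / 2) h1 hhalf)
      (by simp [Fin.forall_fin_two, affineMap]; norm_num)
    obtain rfl := hf.landsIn_eq hO hd ⟨1, hIoo⟩ hj (hρ i)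
    refine hf.landsIn_eq hO hc (x := squarePoint 0 (1 / 2) h0 hhalf) ⟨1, hIoo⟩ ?_ (hσ (O.right i))
    refine hj.of_eq (O.point_right i _ _ rfl rfl rfl)
      (y' := squarePoint (1 / 2) (1 / 2) hhalf hhalf)
      (funext (Fin.forall_fin_two.2 ⟨?_, ?_⟩)) fun y hy => congrArg (O.point _)
        (Subtype.ext (funext (Fin.forall_fin_two.2 ⟨?_, ?_⟩)))
    · simp [affineMap]
    · simp [affineMap]
    · rw [hy]; simp [affineMap]
    · rw [hy]; simp [affineMap]
  have hup : ∀ i, O.up (ρ i) = σ (O.up i) := fun i => by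
    obtain ⟨j, hj⟩ := hf.exists_landsIn hO (b := ![-1, 0]) i
      (x := squarePoint (1 / 2) 1 hhalf h1)
      (by simp [Fin.forall_fin_two, affineMap]; norm_num)
    obtain rfl := hf.landsIn_eq hO hd ⟨0, hIoo⟩ hj (hρ i)
    refine hf.landsIn_eq hO hc (x := squarePoint (1 / 2) 0 hhalf h0) ⟨0, hIoo⟩ ?_ (hσ (O.up i))
    refine hj.of_eq (O.point_up i _ _ rfl rfl rfl) (y' := squarePoint (1 / 2) 0 hhalf h0)
      (funext (Fin.forall_fin_two.2 ⟨?_, ?_⟩)) fun y hy => O.point_up _ _ _ ?_ rfl ?_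
    · simp [affineMap]
    · simp [affineMap]
    · rw [hy]; simp [affineMap]
    · rw [hy]; simp [affineMap]
  exact ⟨σ, fun i => by rw [← hright, hdiag], fun i => by rw [← hup, hdiag]⟩

theorem HasGenus.card_vertex_add_two (h : O.HasGenus 2) : Nat.card O.Vertex + 2 = n := by
  unfold HasGenus eulerChar at h
  push_cast at h
  omega

theorem HasGenus.conePoints_nonempty (h : O.HasGenus 2) : O.conePoints.Nonempty := by
  have hcard := h.card_vertex_add_two
  have : ∃ i, O.turn i ≠ i := by
    by_contra! hfix
    have hinj : Function.Injective
        (Quotient.mk (Equiv.Perm.SameCycle.setoid O.turn)) := fun i j hij =>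
      (Quotient.exact (s := Equiv.Perm.SameCycle.setoid O.turn) hij).eq_of_left (hfix i)
    have := Nat.card_le_card_of_injective _ hinj
    rw [Nat.card_fin] at this
    unfold Vertex at hcard
    omega
  obtain ⟨i, hi⟩ := this
  exact ⟨_, i, ⟨0, by simp⟩, rfl, hi, rfl⟩

end SquareTiledSurface

theorem theorem1p3 {n : ℕ} (O : SquareTiledSurface n) (hgenus : O.HasGenus 2)
    (hreduced : O.IsReduced) :
    O.veechGroup ≠
      ((Matrix.SpecialLinearGroup.map (n := Fin 2) (Int.castRingHom ℝ)).range :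
        Set (Matrix.SpecialLinearGroup (Fin 2) ℝ)) := by
  intro h
  have hO := hgenus.conePoints_nonempty
  have hmem : ∀ A : Matrix.SpecialLinearGroup (Fin 2) ℤ,
      ∃ f : O.Surface ≃ₜ O.Surface, O.IsAffine (A.1.map (Int.castRingHom ℝ)) f := fun A => by
    have : Matrix.SpecialLinearGroup.map (Int.castRingHom ℝ) A ∈ O.veechGroup := by
      rw [h]; exact ⟨A, rfl⟩
    exact this
  obtain ⟨f, hf⟩ := hmem ⟨!![0, -1; 1, 0], by simp [Matrix.det_fin_two]⟩
  obtain ⟨g, hg⟩ := hmem ⟨!![1, 1; 0, 1], by simp [Matrix.det_fin_two]⟩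
  obtain ⟨τ, hτr, hτu⟩ := SquareTiledSurface.exists_perm_of_isAffine_quarterTurn hf hO
  obtain ⟨σ, hσr, hσu⟩ := SquareTiledSurface.exists_perm_of_isAffine_shear hg hO
  have e1 : τ * O.right = O.up * τ := Equiv.ext hτr
  have e2 : O.right * (τ * O.up) = τ := Equiv.ext hτu
  have e3 : σ * O.right = O.right * σ := Equiv.ext hσr
  have e4 : σ * O.up = O.up * (O.right * σ) := Equiv.ext hσu
  -- `τ` is followed by a change of base square, so that the commutator is preserved exactly
  refine not_quarterTurn_and_shear_invariant (δ := O.up * τ⁻¹) (σ := σ) O.connected ?_ ?_ ?_ ?_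
    (hgenus.card_vertex_add_two.trans (Fintype.card_fin n).symm)
  · have : O.right = τ * O.up⁻¹ * τ⁻¹ := by rw [eq_mul_inv_iff_mul_eq, eq_mul_inv_iff_mul_eq,
      mul_assoc, e2]
    rw [MulAut.conj_apply, this]; group
  · have : O.up = τ * O.right * τ⁻¹ := by rw [e1, mul_inv_cancel_right]
    rw [MulAut.conj_apply]
    nth_rewrite 2 [this]
    group
  · rw [MulAut.conj_apply, e3, mul_inv_cancel_right]
  · rw [MulAut.conj_apply, e4, ← mul_assoc, mul_inv_cancel_right]
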